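/- Circuits are built from the gates $\wedge Z$ (controlled-$Z$, on two distinct wires) and $J(\alpha)=\frac1{\sqrt2}\begin{pmatrix}1&e^{i\alpha}\\1&-e^{i\alpha}\end{pmatrix}$. The size of a circuit is its number of gates, and its depth is the largest number of gates on a left-to-right path through the circuit. A measurement pattern is a sequence of commands, executed from right to left, on a set of qubits containing input and output qubits (the non-input qubits being prepared in $|+\rangle$): entanglements $E_{ij}=\wedge Z_{ij}$, measurements ${}_t[M_i^{\alpha}]^s=M_i^{(-1)^s\alpha+t\pi}$, and corrections $X_i^s$, $Z_i^s$, where the signals $s,t$ are sums modulo 2 of measurement outcomes $s_i$. It is standard if entanglements come first, then measurements, then corrections. The execution digraph of a standard pattern has the qubits as nodes and an arc from $i$ to $j$ whenever a measurement or correction command on $j$ has a signal that contains $s_i$. The (quantum computation) depth of the pattern is the number of vertices on a longest directed path from a node of in-degree zero to a node of out-degree zero in this digraph; its measurement depth is the number of vertices on a longest directed path of measured (non-output) qubits. The pattern corresponding to a circuit is obtained by replacing each $\wedge Z$ by $E_{12}$ and each $J(\alpha)$ by $X_2^{s_1}M_1^{-\alpha}E_{12}$ (with a new qubit $2$), and then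 performing standardization, that is, applying until no longer possible the rules $$E_{ij}X_i^s\Rightarrow X_i^sZ_j^sE_{ij},\quad E_{ij}Z_i^s\Rightarrow Z_i^sE_{ij},\quad {}_t[M_i^\alpha]^sX_i^r\Rightarrow{}_t[M_i^\alpha]^{s+r},\quad {}_t[M_i^\alpha]^sZ_i^r\Rightarrow{}_{r+t}[M_i^\alpha]^{s}$$ together with the free commutation rules for commands on disjoint sets of qubits (which move entanglements to the right and corrections to the left), and then performing signal shifting, that is, applying until no longer possible the rules ${}_t[M_i^\alpha]^s\Rightarrow S_i^t\,[M_i^\alpha]^s$ (for $t\neq 0$) and $$X_j^sS_i^t\Rightarrow S_i^tX_j^{s[(t+s_i)/s_i]},\quad Z_j^sS_i^t\Rightarrow S_i^tZ_j^{s[(t+s_i)/s_i]},\quad {}_t[M_j^\alpha]^sS_i^r\Rightarrow S_i^r\;{}_{t[(r+s_i)/s_i]}[M_j^\alpha]^{s[(r+s_i)/s_i]},$$ where a command $S_i^t$ that has reached the left end is discarded. The cluster pattern of a circuit is obtained in the same way after inserting, between any two consecutive $\wedge Z$ gates on a common wire, the teleportation pattern $X_k^{s_j}Z_k^{s_i}M_j^0M_i^0E_{jk}E_{ij}$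 (with new qubits $j,k$). **Proposition.** Let $C$ be a circuit of $\wedge Z$ and $J$ gates on $n$ qubits, with $G_2$ gates $J$, size $s$ and depth $D$, and let $m$ be the number of positions on the wires of $C$ at which two $\wedge Z$ gates directly follow each other. 1. $C$ has a corresponding pattern. Each pattern corresponding to $C$ is standard, its execution digraph is acyclic, and it has $n+G_2$ qubits, $G_2$ measurement commands, $n$ corrections (one correction $X_i^{x_i}Z_i^{z_i}$, possibly with empty signals, for each of the $n$ output qubits $i$, and no correction on any other qubit), measurement depth at most $D$, and depth at most $D+1$. 2. $C$ has a cluster pattern. Each cluster pattern of $C$ is standard, its execution digraph is acyclic, and it has $n+G_2+2m$ qubits. There is an absolute constant $c$ such that, for all $n$ and $C$, one has $n+G_2+2m\le c\,(n+s)$, and, if $C$ has at least one gate, each cluster pattern of $C$ has depth at most $c\,D$. -/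

import Mathlib

namespace MBQC

/-! ## Circuits of controlled-Z and J gates -/

/-- The gates: a controlled-Z on two distinct wires, or `J(α)` on one wire. -/
inductive Gate (n : ℕ) where
  | CZ (a b : Fin n) (h : a ≠ b) : Gate n
  | J (w : Fin n) (α : Real.Angle) : Gate n

/-- The gate acts on the wire `w`. -/
def Gate.Touches {n : ℕ} : Gate n → Fin n → Prop
  | .CZ a b _, w => w = a ∨ w = b
  | .J v _, w => w = v

instance {n : ℕ} (g : Gate n) (w : Fin n) : Decidable (g.Touches w) := by
  cases g <;> unfold Gate.Touches <;> infer_instance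

def Gate.isJ {n : ℕ} : Gate n → Bool
  | .CZ _ _ _ => false
  | .J _ _ => true

def Gate.isCZ {n : ℕ} : Gate n → Bool
  | .CZ _ _ _ => true
  | .J _ _ => false

/-- A circuit on `n` logical qubits: its gates, in the order in which they are applied. -/
abbrev Circuit (n : ℕ) := List (Gate n)

/-- The size is the number of gates. -/
def Circuit.size {n : ℕ} (C : Circuit n) : ℕ := List.length C

/-- The number of `J` gates. -/
def Circuit.numJ {n : ℕ} (C : Circuit n) : ℕ := List.countP Gate.isJ C

/-- `p` lists, in order of application, gates met along a left-to-right path through the circuit: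
one passes from a gate to a later one along a wire on which both act. -/
def Circuit.IsPath {n : ℕ} (C : Circuit n) (p : List (Gate n)) : Prop :=
  List.Sublist p C ∧ p.IsChain (fun g h => ∃ w, g.Touches w ∧ h.Touches w)

/-- The depth is the largest number of gates on a path. (The set below contains `0` and is bounded
by the size of the circuit.) -/
noncomputable def Circuit.depth {n : ℕ} (C : Circuit n) : ℕ :=
  sSup {k | ∃ p, C.IsPath p ∧ p.length = k}

/-- The number of adjacent pairs of controlled-Z gates in a list of gates. -/
def czPairs {n : ℕ} : List (Gate n) → ℕ
  | g :: h :: C => (if g.isCZ && h.isCZ then 1 else 0) + czPairs (h :: C)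
  | _ => 0

/-- The number of positions, on the wires of the circuit, at which two controlled-Z gates
directly follow each other. -/
def Circuit.numConsecutiveCZ {n : ℕ} (C : Circuit n) : ℕ :=
  ∑ w : Fin n, czPairs (List.filter (fun g => decide (g.Touches w)) C)

/-! ## Measurement patterns -/

/-- The commands on qubits named by `Q`. A signal (a sum modulo 2 of measurement outcomes)
is given by its domain, so that sums of signals are symmetric differences.
Non-input qubits are implicitly prepared in the state `|+⟩`. -/
inductive Command (Q : Type) where
  /-- entanglement (controlled-Z) of the qubits `i` and `j` -/
  | E (i j : Q) : Command Q
  /-- measurement of `i` with angle `α`, `X`-dependency `s` and `Z`-dependency `t`, that is,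
  with the actual angle `(-1)^s α + t π` -/
  | M (i : Q) (α : Real.Angle) (s t : Finset Q) : Command Q
  /-- the dependent correction `X_i^s` -/
  | X (i : Q) (s : Finset Q) : Command Q
  /-- the dependent correction `Z_i^s` -/
  | Z (i : Q) (s : Finset Q) : Command Q
  /-- the signal shifting command, which adds the signal `t` to the outcome of `i` -/
  | S (i : Q) (t : Finset Q) : Command Q

namespace Command

variable {Q : Type}

def isEntanglement : Command Q → Bool
  | E _ _ => true
  | _ => false

def isMeasurement : Command Q → Bool
  | M _ _ _ _ => true
  | _ => false

def isCorrection : Command Q → Bool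
  | X _ _ => true
  | Z _ _ => true
  | _ => false

/-- The command acts on the qubit `q`. -/
def ActsOn : Command Q → Q → Prop
  | E i j, q => q = i ∨ q = j
  | M i _ _ _, q => q = i
  | X i _, q => q = i
  | Z i _, q => q = i
  | S i _, q => q = i

end Command

/-- A pattern. The commands are listed as they are usually written: they are executed from right
to left, so the head of the list is the last command. -/
structure Pattern (Q : Type) where
  qubits : Finset Q
  inputs : Finset Q
  outputs : Finset Q
  commands : List (Command Q)

namespace Pattern

variable {Q : Type}

/-- Standard form: first entanglement, then measurements, then corrections. -/
def IsStandard (P : Pattern Q) : Prop :=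
  ∃ cs ms es : List (Command Q), P.commands = cs ++ ms ++ es ∧
    (∀ c ∈ cs, c.isCorrection = true) ∧ (∀ c ∈ ms, c.isMeasurement = true) ∧
    (∀ c ∈ es, c.isEntanglement = true)

def numMeasurements (P : Pattern Q) : ℕ := P.commands.countP Command.isMeasurement

/-- The sum modulo 2 of the exponents of the `X`-corrections of the qubit `i`. -/
def xExponent [DecidableEq Q] (P : Pattern Q) (i : Q) : Finset Q :=
  P.commands.foldr
    (fun c r => match c with
      | .X j s => if j = i then symmDiff s r else r
      | _ => r) ∅

/-- The sum modulo 2 of the exponents of the `Z`-corrections of the qubit `i`. -/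
def zExponent [DecidableEq Q] (P : Pattern Q) (i : Q) : Finset Q :=
  P.commands.foldr
    (fun c r => match c with
      | .Z j s => if j = i then symmDiff s r else r
      | _ => r) ∅

/-- The corrections, collected qubit by qubit: one correction `X_i^x Z_i^z`, written `(i, x, z)`,
for each output qubit `i` (the exponents may be the empty sum). -/
def corrections [DecidableEq Q] (P : Pattern Q) : Finset (Q × Finset Q × Finset Q) :=
  P.outputs.image (fun i => (i, P.xExponent i, P.zExponent i))

/-- The arcs of the execution digraph: from `i` to `j` whenever a measurement or a correction of
`j` has `i` in the domain of one of its signals. -/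
def Arc (P : Pattern Q) (i j : Q) : Prop :=
  (∃ α s t, Command.M j α s t ∈ P.commands ∧ (i ∈ s ∨ i ∈ t)) ∨
  (∃ s, (Command.X j s ∈ P.commands ∨ Command.Z j s ∈ P.commands) ∧ i ∈ s)

/-- The execution digraph has no directed cycle. -/
def Acyclic (P : Pattern Q) : Prop := ∀ v, ¬ Relation.TransGen P.Arc v v

/-- Directed paths in the execution digraph, as lists of vertices. -/
def IsDirectedPath (P : Pattern Q) (p : List Q) : Prop :=
  (∀ v ∈ p, v ∈ P.qubits) ∧ p.IsChain P.Arc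

/-- A node of in-degree zero. -/
def IsStart (P : Pattern Q) (v : Q) : Prop := ∀ u, ¬ P.Arc u v

/-- A node of out-degree zero. -/
def IsEnd (P : Pattern Q) (v : Q) : Prop := ∀ u, ¬ P.Arc v u

/-- The quantum computation depth of a standard pattern: the number of vertices on a longest
directed path from a start node to an end node of the execution digraph. -/
noncomputable def depth (P : Pattern Q) : ℕ∞ :=
  ⨆ (p : List Q) (_ : P.IsDirectedPath p ∧
    ∃ h : p ≠ [], P.IsStart (p.head h) ∧ P.IsEnd (p.getLast h)), (p.length : ℕ∞)

/-- The number of layers of measurements: the number of vertices on a longest directed path of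
measured (that is, non-output) qubits in the execution digraph. -/
noncomputable def measurementDepth (P : Pattern Q) : ℕ∞ :=
  ⨆ (p : List Q) (_ : P.IsDirectedPath p ∧ ∀ v ∈ p, v ∉ P.outputs), (p.length : ℕ∞)

end Pattern

/-! ## Standardization and signal shifting -/

section Rewriting

variable {Q : Type} [DecidableEq Q]

/-- The rewrite rules of standardization, with the free commutation rules. The entanglement
command is symmetric in its two qubits, so its rules come in two copies. -/
inductive StdRule : List (Command Q) → List (Command Q) → Prop
  | EX_left (i j : Q) (s : Finset Q) : StdRule [.E i j, .X i s] [.X i s, .Z j s, .E i j]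
  | EX_right (i j : Q) (s : Finset Q) : StdRule [.E i j, .X j s] [.X j s, .Z i s, .E i j]
  | EZ_left (i j : Q) (s : Finset Q) : StdRule [.E i j, .Z i s] [.Z i s, .E i j]
  | EZ_right (i j : Q) (s : Finset Q) : StdRule [.E i j, .Z j s] [.Z j s, .E i j]
  | MX (i : Q) (α : Real.Angle) (s t r : Finset Q) :
      StdRule [.M i α s t, .X i r] [.M i α (symmDiff s r) t]
  | MZ (i : Q) (α : Real.Angle) (s t r : Finset Q) :
      StdRule [.M i α s t, .Z i r] [.M i α s (symmDiff r t)]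
  | freeE (i j : Q) (A : Command Q) (hA : A.isEntanglement = false)
      (hi : ¬ A.ActsOn i) (hj : ¬ A.ActsOn j) : StdRule [.E i j, A] [A, .E i j]
  | freeX (i : Q) (s : Finset Q) (A : Command Q) (hA : A.isCorrection = false)
      (hi : ¬ A.ActsOn i) : StdRule [A, .X i s] [.X i s, A]
  | freeZ (i : Q) (s : Finset Q) (A : Command Q) (hA : A.isCorrection = false)
      (hi : ¬ A.ActsOn i) : StdRule [A, .Z i s] [.Z i s, A]

/-- One standardization step: a rule is applied somewhere in the command sequence. -/
inductive StdStep : List (Command Q) → List (Command Q) → Prop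
  | mk (u v l r : List (Command Q)) (h : StdRule l r) : StdStep (u ++ l ++ v) (u ++ r ++ v)

/-- The signal `s[(t + s_i)/s_i]`: the outcome of `i` is replaced with its sum with `t`. -/
def shiftSignal (s : Finset Q) (i : Q) (t : Finset Q) : Finset Q :=
  if i ∈ s then symmDiff s t else s

/-- The signal shifting rules. -/
inductive SigRule : List (Command Q) → List (Command Q) → Prop
  | create (i : Q) (α : Real.Angle) (s t : Finset Q) (ht : t ≠ ∅) :
      SigRule [.M i α s t] [.S i t, .M i α s ∅]
  | passX (i j : Q) (s t : Finset Q) :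
      SigRule [.X j s, .S i t] [.S i t, .X j (shiftSignal s i t)]
  | passZ (i j : Q) (s t : Finset Q) :
      SigRule [.Z j s, .S i t] [.S i t, .Z j (shiftSignal s i t)]
  | passM (i j : Q) (α : Real.Angle) (s t r : Finset Q) :
      SigRule [.M j α s t, .S i r] [.S i r, .M j α (shiftSignal s i r) (shiftSignal t i r)]

/-- One signal shifting step: a rule is applied somewhere in the command sequence, or a signal
shifting command that no command follows any more in the execution is discarded. -/
inductive SigStep : List (Command Q) → List (Command Q) → Prop
  | mk (u v l r : List (Command Q)) (h : SigRule l r) : SigStep (u ++ l ++ v) (u ++ r ++ v)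
  | discard (i : Q) (t : Finset Q) (v : List (Command Q)) : SigStep (.S i t :: v) v

/-- `y` is obtained from `x` by applying rules until none is applicable. -/
def RewritesTo {α : Type} (r : α → α → Prop) (x y : α) : Prop :=
  Relation.ReflTransGen r x y ∧ ∀ z, ¬ r y z

/-- `P` is obtained from `R` by standardization followed by signal shifting. -/
def Pattern.Simplifies (R P : Pattern Q) : Prop :=
  P.qubits = R.qubits ∧ P.inputs = R.inputs ∧ P.outputs = R.outputs ∧
  ∃ l, RewritesTo StdStep R.commands l ∧ RewritesTo SigStep l P.commands

end Rewriting

/-! ## From circuits to patterns -/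

/-- What is translated: the gates of a circuit, and teleportations (identities) on a wire. -/
inductive Element (n : ℕ) where
  | gate (g : Gate n) : Element n
  | teleport (w : Fin n) : Element n

/-- `(w, k)` is the `k`-th qubit, from the left, on the wire `w`. -/
abbrev Qubit (n : ℕ) := Fin n × ℕ

/-- If `(w, k w)` is the current last qubit of each wire `w`, then `e.advance k` gives the
last qubits after the element `e`. -/
def Element.advance {n : ℕ} : Element n → (Fin n → ℕ) → (Fin n → ℕ)
  | .gate (.CZ _ _ _), k => k
  | .gate (.J w _), k => Function.update k w (k w + 1)
  | .teleport w, k => Function.update k w (k w + 2)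

/-- The pattern that replaces an element: `E_12` for a controlled-Z, `X_2^{s_1} M_1^{-α} E_12` for
`J(α)`, and `X_3^{s_2} Z_3^{s_1} M_2^0 M_1^0 E_23 E_12` for a teleportation. -/
noncomputable def Element.commands {n : ℕ} : Element n → (Fin n → ℕ) → List (Command (Qubit n))
  | .gate (.CZ a b _), k => [.E (a, k a) (b, k b)]
  | .gate (.J w α), k =>
      [.X (w, k w + 1) {(w, k w)}, .M (w, k w) (-α) ∅ ∅, .E (w, k w) (w, k w + 1)]
  | .teleport w, k =>
      [.X (w, k w + 2) {(w, k w + 1)}, .Z (w, k w + 2) {(w, k w)},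
       .M (w, k w + 1) 0 ∅ ∅, .M (w, k w) 0 ∅ ∅,
       .E (w, k w + 1) (w, k w + 2), .E (w, k w) (w, k w + 1)]

/-- The commands for a sequence of elements; later elements stand further left. -/
noncomputable def commandsFrom {n : ℕ} : List (Element n) → (Fin n → ℕ) → List (Command (Qubit n))
  | [], _ => []
  | e :: l, k => commandsFrom l (e.advance k) ++ e.commands k

/-- The last qubits of the wires after a sequence of elements. -/
def lastFrom {n : ℕ} : List (Element n) → (Fin n → ℕ) → (Fin n → ℕ)
  | [], k => k
  | e :: l, k => lastFrom l (e.advance k)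

/-- The (wild) pattern obtained by replacing each element with its pattern: outputs of earlier
pieces are the inputs of later ones. -/
noncomputable def wildPattern {n : ℕ} (l : List (Element n)) : Pattern (Qubit n) where
  qubits := Finset.univ.biUnion fun w =>
    (Finset.range (lastFrom l (fun _ => 0) w + 1)).image fun j => (w, j)
  inputs := Finset.univ.image fun w => (w, 0)
  outputs := Finset.univ.image fun w => (w, lastFrom l (fun _ => 0) w)
  commands := commandsFrom l (fun _ => 0)

/-- `P` is the pattern corresponding to the circuit `C`: each gate is replaced with its pattern,
then standardization and signal shifting are performed. -/
def Corresponds {n : ℕ} (C : Circuit n) (P : Pattern (Qubit n)) : Prop :=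
  (wildPattern (C.map Element.gate)).Simplifies P

/-- Inserts a teleportation between any two consecutive controlled-Z gates on a common wire;
`last w` tells whether the previous gate on the wire `w` is a controlled-Z. -/
def insertTeleports {n : ℕ} : Circuit n → (Fin n → Bool) → List (Element n)
  | [], _ => []
  | .J w α :: C, last =>
      .gate (.J w α) :: insertTeleports C (Function.update last w false)
  | .CZ a b h :: C, last =>
      (if last a then [.teleport a] else []) ++ (if last b then [.teleport b] else []) ++
        .gate (.CZ a b h) ::
          insertTeleports C (Function.update (Function.update last a true) b true)

/-- `P` is the pattern with cluster geometry that corresponds to `C`: as before, after insertion of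
the teleportation patterns. -/
def ClusterCorresponds {n : ℕ} (C : Circuit n) (P : Pattern (Qubit n)) : Prop :=
  (wildPattern (insertTeleports C (fun _ => false))).Simplifies P

end MBQC

/-!
Both rewriting systems terminate, because commands can be interpreted as strictly increasing
functions on the natural numbers such that each rule decreases the composite
(`StdRule.weight_lt`, `SigRule.weight_lt`). Hence simplified patterns exist.

Normal forms need not be computed, nor be shown to be unique. Give each measured qubit as its height
the length of a longest path of the circuit that ends with the gate (or teleportation) by which the
qubit is measured, and each output qubit one more than the length of a longest path that ends on its
wire (`IsHeight`). In the translated circuit all signals of commands on a qubit refer to qubits of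
smaller height. Signal shifting preserves this: if `i` occurs in a signal on `j`, and `i` is replaced
by its sum with a signal `t` on `i`, then the qubits in `t` are lower than `i`, and so lower than
`j`. Standardization moves a signal to another qubit only when an entanglement `E_ij` meets an
`X`-correction of `i`, which yields a `Z`-correction of `j`. An entanglement comes from an element
that is executed after the correction was created and before `j` is measured, so that the qubits in
the signal are lower than `j`. With the condition that measured qubits are neither entangled nor
corrected afterwards, this is an invariant of both systems (`StdRule.invariant`,
`SigRule.invariant`), which the translated circuit satisfies (`IsHeight.invariant`).

In a normal form of standardization no adjacent commands are in the wrong order, and in a normal form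
of signal shifting no shifting command is left, so the pattern is standard. Along the arcs of its
execution digraph the height increases. So there is no cycle, and the number of vertices on a
directed path is bounded by the largest height, which is at most the depth of the circuit for
measured qubits and one more for output qubits. The teleportations inserted for the cluster pattern
at most double the depth (`levelFrom_insertTeleports_le`).
-/

namespace MBQC

/-! ### Termination of the two rewriting systems -/

/-- A relation that decreases a natural number has normal forms. -/
theorem exists_rewritesTo {α : Type} {r : α → α → Prop} (f : α → ℕ)
    (hf : ∀ x y, r x y → f y < f x) (x : α) : ∃ y, RewritesTo r x y := by
  induction hx : f x using Nat.strong_induction_on generalizing x with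
  | _ m ih =>
    by_cases h : ∃ y, r x y
    · obtain ⟨y, hy⟩ := h
      obtain ⟨z, hz, hn⟩ := ih (f y) (hx ▸ hf x y hy) y rfl
      exact ⟨z, hz.head hy, hn⟩
    · exact ⟨x, .refl, fun z hz => h ⟨z, hz⟩⟩

/-- A property that every step preserves passes to the normal forms. -/
theorem RewritesTo.preserves {α : Type} {r : α → α → Prop} {p : α → Prop}
    (hp : ∀ x y, r x y → p x → p y) {x y : α} (h : RewritesTo r x y) (hx : p x) : p y := by
  obtain ⟨h, -⟩ := h
  induction h with
  | refl => exact hx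
  | tail _ hs ih => exact hp _ _ hs ih

section

variable {Q : Type}

/-- The interpretation of a command as a strictly increasing function for the termination of
standardization. Corrections are translations, and the functions of the other commands stretch
them: that of `E` by `3`, enough to pay for the extra `Z`-correction. -/
def stdWeight : Command Q → ℕ → ℕ
  | .E _ _, m => 3 * m
  | .M _ _ _ _, m => 2 * m + 1
  | .S _ _, m => 2 * m + 1
  | .X _ _, m => m + 1
  | .Z _ _, m => m + 1

/-- The interpretation of a command as a strictly increasing function for the termination of
signal shifting. A measurement with empty `Z`-dependency is cheaper, and its `Z`-dependency remains
empty, so that it never creates a signal shifting command again. -/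
def sigWeight [DecidableEq Q] : Command Q → ℕ → ℕ
  | .E _ _, m => m
  | .M _ _ _ t, m => if t = ∅ then 2 * m + 1 else 2 * m + 3
  | .S _ _, m => m + 1
  | .X _ _, m => 2 * m
  | .Z _ _, m => 2 * m

theorem stdWeight_strictMono (c : Command Q) : StrictMono (stdWeight c) := by
  intro a b h
  cases c <;> simp only [stdWeight] <;> omega

theorem foldr_strictMono {α : Type} {f : α → ℕ → ℕ} (hf : ∀ a, StrictMono (f a)) (l : List α) :
    StrictMono fun m => l.foldr f m := by
  induction l with
  | nil => exact strictMono_id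
  | cons a l ih => exact (hf a).comp ih

variable [DecidableEq Q]

theorem sigWeight_strictMono (c : Command Q) : StrictMono (sigWeight c) := by
  intro a b h
  cases c <;> simp only [sigWeight] <;> try split_ifs
  all_goals omega

theorem StdRule.weight_lt {l r : List (Command Q)} (h : StdRule l r) (m : ℕ) :
    r.foldr stdWeight m < l.foldr stdWeight m := by
  cases h with
  | freeE i j A hA hi hj =>
    cases A <;> simp_all [stdWeight, Command.isEntanglement] <;> omega
  | freeX i s A hA hi =>
    cases A <;> simp_all [stdWeight, Command.isCorrection, Command.ActsOn] <;> omega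
  | freeZ i s A hA hi =>
    cases A <;> simp_all [stdWeight, Command.isCorrection, Command.ActsOn] <;> omega
  | _ => simp [stdWeight]; try omega

theorem shiftSignal_empty (i : Q) (t : Finset Q) : shiftSignal ∅ i t = ∅ := by
  simp [shiftSignal]

theorem SigRule.weight_lt {l r : List (Command Q)} (h : SigRule l r) (m : ℕ) :
    r.foldr sigWeight m < l.foldr sigWeight m := by
  cases h with
  | create i α s t ht => simp [sigWeight, ht]
  | passX => simp [sigWeight]; omega
  | passZ => simp [sigWeight]; omega
  | passM i j α s t r =>
    -- An empty `Z`-dependency remains empty; otherwise the measurement only becomes cheaper.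
    by_cases ht : t = ∅
    · simp only [sigWeight, ht, shiftSignal_empty, List.foldr_cons, List.foldr_nil, if_true]
      omega
    · simp only [sigWeight, ht, List.foldr_cons, List.foldr_nil, if_false]
      split_ifs <;> omega

theorem exists_rewritesTo_stdStep (x : List (Command Q)) : ∃ y, RewritesTo StdStep x y := by
  refine exists_rewritesTo (fun l => l.foldr stdWeight 0) ?_ x
  rintro _ _ ⟨u, v, l, r, h⟩
  simpa using foldr_strictMono stdWeight_strictMono u (h.weight_lt _)

theorem exists_rewritesTo_sigStep (x : List (Command Q)) : ∃ y, RewritesTo SigStep x y := by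
  refine exists_rewritesTo (fun l => l.foldr sigWeight 0) ?_ x
  rintro _ _ (⟨u, v, l, r, h⟩ | ⟨i, t, v⟩)
  · simpa using foldr_strictMono sigWeight_strictMono u (h.weight_lt _)
  · simp [sigWeight]

theorem Pattern.exists_simplifies (R : Pattern Q) : ∃ P, R.Simplifies P := by
  obtain ⟨l, hl⟩ := exists_rewritesTo_stdStep R.commands
  obtain ⟨l', hl'⟩ := exists_rewritesTo_sigStep l
  exact ⟨⟨R.qubits, R.inputs, R.outputs, l'⟩, rfl, rfl, rfl, l, hl, hl'⟩

end

section

variable {Q : Type}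

/-! ### Invariants of the rewriting systems -/

/-- The condition on a single command: its signals refer to qubits that lie below the qubit on
which it acts, and corrections and entanglements act on qubits in `qs`. -/
def Command.Graded (h : Q → ℕ) (qs : Finset Q) : Command Q → Prop
  | .E i j => i ∈ qs ∧ j ∈ qs
  | .M i _ s t => (∀ e ∈ s, h e < h i) ∧ ∀ e ∈ t, h e < h i
  | .X i s => i ∈ qs ∧ ∀ e ∈ s, h e < h i
  | .Z i s => i ∈ qs ∧ ∀ e ∈ s, h e < h i
  | .S i t => ∀ e ∈ t, h e < h i

/-- The condition on two commands, the second of which is executed before the first: a measured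
qubit is neither entangled nor corrected any more, and an entanglement through which an
`X`-correction passes turns it into a graded `Z`-correction. -/
def Command.Compatible (h : Q → ℕ) : Command Q → Command Q → Prop
  | .E i j, .X q s => (q = i → ∀ e ∈ s, h e < h j) ∧ (q = j → ∀ e ∈ s, h e < h i)
  | .E i j, .M q _ _ _ => q ≠ i ∧ q ≠ j
  | .X i _, .M q _ _ _ => q ≠ i
  | .Z i _, .M q _ _ _ => q ≠ i
  | _, _ => True

/-- The order of a standard pattern, in which signal shifting commands may stand anywhere to the
left of the entanglements. -/
def Command.InOrder : Command Q → Command Q → Prop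
  | .E _ _, .E _ _ => True
  | .E _ _, _ => False
  | .M _ _ _ _, .X _ _ => False
  | .M _ _ _ _, .Z _ _ => False
  | _, _ => True

/-- The qubit that a command measures. -/
def Command.measured : Command Q → Option Q
  | .M i _ _ _ => some i
  | _ => none

/-- The command is not a signal shifting command. -/
def Command.NotShift : Command Q → Prop
  | .S _ _ => False
  | _ => True

/-- All commands satisfy `p`, and any two of them, from left to right, satisfy `R`. -/
def Invariant (p : Command Q → Prop) (R : Command Q → Command Q → Prop)
    (l : List (Command Q)) : Prop :=
  (∀ c ∈ l, p c) ∧ l.Pairwise R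

/-- If replacing `l` with `r` keeps the invariant, and `r` satisfies all relations with other
commands that `l` satisfies, then the invariant is kept in any context. -/
theorem Invariant.replace {p : Command Q → Prop} {R : Command Q → Command Q → Prop}
    {l r : List (Command Q)} (hlr : Invariant p R l → Invariant p R r ∧
      (∀ a, (∀ b ∈ l, R a b) → ∀ b ∈ r, R a b) ∧ (∀ a, (∀ b ∈ l, R b a) → ∀ b ∈ r, R b a))
    {u v : List (Command Q)} (h : Invariant p R (u ++ l ++ v)) :
    Invariant p R (u ++ r ++ v) := by
  obtain ⟨h1, h2⟩ := h
  simp only [List.pairwise_append, List.mem_append] at h1 h2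
  obtain ⟨⟨hr1, hr2⟩, hL, hR⟩ := hlr ⟨fun c hc => h1 c (by simp [hc]), h2.1.2.1⟩
  refine ⟨?_, ?_⟩
  · simp only [List.mem_append]
    rintro c ((hc | hc) | hc)
    · exact h1 c (by simp [hc])
    · exact hr1 c hc
    · exact h1 c (by simp [hc])
  · simp only [List.pairwise_append, List.mem_append]
    refine ⟨⟨h2.1.1, hr2, fun a ha => hL a fun b hb => h2.1.2.2 a ha b hb⟩, h2.2.1, ?_⟩
    rintro a (ha | ha) b hb
    · exact h2.2.2 a (.inl ha) b hb
    · exact hR b (fun c hc => h2.2.2 c (.inr hc) b hb) a ha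

variable [DecidableEq Q]

theorem forall_mem_symmDiff {p : Q → Prop} {s t : Finset Q} (hs : ∀ e ∈ s, p e)
    (ht : ∀ e ∈ t, p e) : ∀ e ∈ symmDiff s t, p e := by
  intro e he
  rw [Finset.mem_symmDiff] at he
  exact he.elim (fun h => hs e h.1) (fun h => ht e h.1)

theorem forall_mem_shiftSignal {h : Q → ℕ} {m : ℕ} {s t : Finset Q} {i : Q}
    (hs : ∀ e ∈ s, h e < m) (ht : ∀ e ∈ t, h e < h i) : ∀ e ∈ shiftSignal s i t, h e < m := by
  unfold shiftSignal
  split_ifs with hi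
  · exact forall_mem_symmDiff hs fun e he => (ht e he).trans (hs i hi)
  · exact hs

open Command in
theorem StdRule.invariant {h : Q → ℕ} {qs : Finset Q} {l r : List (Command Q)}
    (hlr : StdRule l r) (hl : Invariant (Graded h qs) (Compatible h) l) :
    Invariant (Graded h qs) (Compatible h) r ∧
      (∀ a, (∀ b ∈ l, Compatible h a b) → ∀ b ∈ r, Compatible h a b) ∧
      (∀ a, (∀ b ∈ l, Compatible h b a) → ∀ b ∈ r, Compatible h b a) := by
  cases hlr with
  | MX i α s t r =>
    simp only [Invariant, List.mem_cons, List.not_mem_nil, or_false, forall_eq_or_imp, forall_eq,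
      List.pairwise_cons, Graded] at hl ⊢
    refine ⟨⟨⟨forall_mem_symmDiff hl.1.1.1 hl.1.2.2, hl.1.1.2⟩, by simp⟩, ?_, ?_⟩
    all_goals intro a; cases a <;> simp +contextual [Compatible]
  | MZ i α s t r =>
    simp only [Invariant, List.mem_cons, List.not_mem_nil, or_false, forall_eq_or_imp, forall_eq,
      List.pairwise_cons, Graded] at hl ⊢
    refine ⟨⟨⟨hl.1.1.1, forall_mem_symmDiff hl.1.2.2 hl.1.1.2⟩, by simp⟩, ?_, ?_⟩
    all_goals intro a; cases a <;> simp +contextual [Compatible]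
  | freeE i j A hA hi hj =>
    refine ⟨⟨fun c hc => hl.1 c (by simp at hc ⊢; tauto), ?_⟩, fun a ha b hb => ha b ?_,
      fun a ha b hb => ha b ?_⟩
    · cases A <;> simp_all [isEntanglement, Compatible]
    all_goals simp at hb ⊢; tauto
  | freeX i s A hA hi =>
    refine ⟨⟨fun c hc => hl.1 c (by simp at hc ⊢; tauto), ?_⟩, fun a ha b hb => ha b ?_,
      fun a ha b hb => ha b ?_⟩
    · cases A <;> simp_all [isCorrection, Compatible, ActsOn, eq_comm]
    all_goals simp at hb ⊢; tauto
  | freeZ i s A hA hi =>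
    refine ⟨⟨fun c hc => hl.1 c (by simp at hc ⊢; tauto), ?_⟩, fun a ha b hb => ha b ?_,
      fun a ha b hb => ha b ?_⟩
    · cases A <;> simp_all [isCorrection, Compatible, ActsOn, eq_comm]
    all_goals simp at hb ⊢; tauto
  | _ =>
    simp only [Invariant, List.mem_cons, List.not_mem_nil, or_false, forall_eq_or_imp, forall_eq,
      List.pairwise_cons, Graded, Compatible] at hl ⊢
    refine ⟨by simp_all, ?_, ?_⟩
    all_goals intro a; cases a <;> simp +contextual

open Command in
theorem SigRule.invariant {h : Q → ℕ} {qs : Finset Q} {l r : List (Command Q)}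
    (hlr : SigRule l r) (hl : Invariant (Graded h qs) (Compatible h) l) :
    Invariant (Graded h qs) (Compatible h) r ∧
      (∀ a, (∀ b ∈ l, Compatible h a b) → ∀ b ∈ r, Compatible h a b) ∧
      (∀ a, (∀ b ∈ l, Compatible h b a) → ∀ b ∈ r, Compatible h b a) := by
  cases hlr <;>
    simp only [Invariant, List.mem_cons, List.not_mem_nil, or_false, forall_eq_or_imp, forall_eq,
      List.pairwise_cons, Graded, Compatible] at hl ⊢
  case create =>
    refine ⟨by simp_all, ?_, ?_⟩
    all_goals intro a; cases a <;> simp +contextual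
  case passX =>
    refine ⟨⟨⟨hl.1.2, hl.1.1.1, forall_mem_shiftSignal hl.1.1.2 hl.1.2⟩, by simp⟩, ?_, ?_⟩
    · intro a
      cases a <;> simp only [implies_true, and_true, true_and]
      exact fun ha => ⟨fun hq => forall_mem_shiftSignal (ha.1 hq) hl.1.2,
        fun hq => forall_mem_shiftSignal (ha.2 hq) hl.1.2⟩
    · intro a; cases a <;> simp +contextual
  case passZ =>
    refine ⟨⟨⟨hl.1.2, hl.1.1.1, forall_mem_shiftSignal hl.1.1.2 hl.1.2⟩, by simp⟩, ?_, ?_⟩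
    all_goals intro a; cases a <;> simp +contextual
  case passM =>
    refine ⟨⟨⟨hl.1.2, forall_mem_shiftSignal hl.1.1.1 hl.1.2,
      forall_mem_shiftSignal hl.1.1.2 hl.1.2⟩, by simp⟩, ?_, ?_⟩
    all_goals intro a; cases a <;> simp +contextual

open Command in
theorem StdStep.invariant {h : Q → ℕ} {qs : Finset Q} (x y : List (Command Q))
    (hxy : StdStep x y) (hx : Invariant (Graded h qs) (Compatible h) x) :
    Invariant (Graded h qs) (Compatible h) y := by
  obtain ⟨u, v, l, r, hr⟩ := hxy
  exact hx.replace hr.invariant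

open Command in
theorem SigStep.invariant {h : Q → ℕ} {qs : Finset Q} (x y : List (Command Q))
    (hxy : SigStep x y) (hx : Invariant (Graded h qs) (Compatible h) x) :
    Invariant (Graded h qs) (Compatible h) y := by
  obtain ⟨u, v, l, r, hr⟩ | ⟨i, t, v⟩ := hxy
  · exact hx.replace hr.invariant
  · exact ⟨fun c hc => hx.1 c (by simp [hc]), (List.pairwise_cons.1 hx.2).2⟩

open Command in
theorem SigStep.inOrder (x y : List (Command Q)) (hxy : SigStep x y)
    (hx : Invariant (fun _ => True) InOrder x) : Invariant (fun _ => True) InOrder y := by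
  obtain ⟨u, v, l, r, hr⟩ | ⟨i, t, v⟩ := hxy
  · refine hx.replace fun _ => ?_
    cases hr <;> refine ⟨by simp [Invariant, InOrder], ?_, ?_⟩ <;> intro a <;>
      cases a <;> simp [InOrder]
  · exact ⟨fun _ _ => trivial, (List.pairwise_cons.1 hx.2).2⟩

open Command in
theorem StdStep.filterMap_measured {x y : List (Command Q)} (hxy : StdStep x y) :
    y.filterMap measured = x.filterMap measured := by
  obtain ⟨u, v, l, r, hr⟩ := hxy
  suffices h : r.filterMap measured = l.filterMap measured by simp [h]
  cases hr with
  | freeE i j A => cases A <;> simp [List.filterMap_cons, measured]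
  | freeX i s A => cases A <;> simp [List.filterMap_cons, measured]
  | freeZ i s A => cases A <;> simp [List.filterMap_cons, measured]
  | _ => simp [List.filterMap_cons, measured]

open Command in
theorem SigStep.filterMap_measured {x y : List (Command Q)} (hxy : SigStep x y) :
    y.filterMap measured = x.filterMap measured := by
  obtain ⟨u, v, l, r, hr⟩ | ⟨i, t, v⟩ := hxy
  · suffices h : r.filterMap measured = l.filterMap measured by simp [h]
    cases hr <;> simp [List.filterMap_cons, measured]
  · simp [List.filterMap_cons, measured]

open Command in
theorem StdStep.notShift (x y : List (Command Q)) (hxy : StdStep x y)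
    (hx : ∀ c ∈ x, c.NotShift) : ∀ c ∈ y, c.NotShift := by
  obtain ⟨u, v, l, r, hr⟩ := hxy
  have hl : ∀ c ∈ l, c.NotShift := fun c hc => hx c (by simp [hc])
  have : ∀ c ∈ r, c.NotShift := by
    cases hr <;> simp_all [NotShift]
  intro c hc
  simp only [List.mem_append] at hc hx
  rcases hc with (hc | hc) | hc
  · exact hx c (by simp [hc])
  · exact this c hc
  · exact hx c (by simp [hc])

/-! ### Normal forms -/

/-- Corrections come first, then measurements, then entanglements. -/
def Command.rank : Command Q → ℕ
  | .E _ _ => 2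
  | .M _ _ _ _ => 1
  | _ => 0

open Command in
/-- In a normal form of standardization, no command could be exchanged with the next one. -/
theorem pairwise_inOrder_of_normal {h : Q → ℕ} {qs : Finset Q} {l : List (Command Q)}
    (hl : Invariant (Graded h qs) (Compatible h) l) (hs : ∀ c ∈ l, c.NotShift)
    (hn : ∀ z, ¬ StdStep l z) : l.Pairwise InOrder := by
  have hc : l.IsChain (fun c d => c.rank ≤ d.rank) := by
    rw [List.isChain_iff_forall_rel_of_append_cons_cons]
    intro c d u v huv
    by_contra hcd
    have hcomp : Compatible h c d := by
      have := hl.2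
      rw [huv, List.pairwise_append, List.pairwise_cons] at this
      exact this.2.1.1 d (by simp)
    have key : ∀ r, ¬ StdRule [c, d] r := fun r hr => by
      have := StdStep.mk u v _ _ hr
      rw [List.append_assoc] at this
      exact hn _ (huv ▸ this)
    have hsc : c.NotShift := hs c (by simp [huv])
    have hsd : d.NotShift := hs d (by simp [huv])
    cases c with
    | E i j =>
      cases d with
      | E => simp [rank] at hcd
      | S => exact hsd
      | M q α s t =>
        exact key _ (.freeE i j _ rfl (fun e => hcomp.1 e.symm) (fun e => hcomp.2 e.symm))
      | X q s =>
        by_cases hi : q = i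
        · subst hi; exact key _ (.EX_left _ _ _)
        by_cases hj : q = j
        · subst hj; exact key _ (.EX_right _ _ _)
        exact key _ (.freeE i j _ rfl (fun e => hi e.symm) (fun e => hj e.symm))
      | Z q s =>
        by_cases hi : q = i
        · subst hi; exact key _ (.EZ_left _ _ _)
        by_cases hj : q = j
        · subst hj; exact key _ (.EZ_right _ _ _)
        exact key _ (.freeE i j _ rfl (fun e => hi e.symm) (fun e => hj e.symm))
    | M i α s t =>
      cases d with
      | E => simp [rank] at hcd
      | M => simp [rank] at hcd
      | S => exact hsd
      | X q s =>
        by_cases hi : q = i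
        · subst hi; exact key _ (.MX _ _ _ _ _)
        exact key _ (.freeX q s _ rfl hi)
      | Z q s =>
        by_cases hi : q = i
        · subst hi; exact key _ (.MZ _ _ _ _ _)
        exact key _ (.freeZ q s _ rfl hi)
    | S => exact hsc
    | _ => simp [rank] at hcd
  have : IsTrans (Command Q) (fun c d => c.rank ≤ d.rank) := ⟨fun _ _ _ => le_trans⟩
  refine (List.isChain_iff_pairwise.1 hc).imp_of_mem ?_
  intro c d hc hd hcd
  have := hs d hd
  cases c <;> cases d <;> simp_all [rank, InOrder, NotShift]

open Command in
theorem notShift_of_normal {l : List (Command Q)} (hl : l.Pairwise InOrder)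
    (hn : ∀ z, ¬ SigStep l z) : ∀ c ∈ l, c.NotShift := by
  have key : ∀ u v i t, l ≠ u ++ Command.S i t :: v := by
    intro u
    induction u using List.reverseRecOn with
    | nil =>
      rintro v i t rfl
      exact hn v (.discard i t v)
    | append_singleton u c ih =>
      intro v i t h
      have hr : ∀ r, ¬ SigRule [c, .S i t] r := fun r hr => by
        have := SigStep.mk u v _ _ hr
        simp only [List.append_assoc, List.cons_append, List.nil_append] at this h
        exact hn _ (h ▸ this)
      cases c with
      | E => simp [h, List.pairwise_append, InOrder] at hl
      | M => exact hr _ (.passM _ _ _ _ _ _)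
      | X => exact hr _ (.passX _ _ _ _)
      | Z => exact hr _ (.passZ _ _ _ _)
      | S j t' => exact ih (.S i t :: v) j t' (by simp [h])
  intro c hc
  obtain ⟨u, v, h⟩ := List.append_of_mem hc
  cases c with
  | S i t => exact key u v i t h
  | _ => trivial

end

section

variable {Q : Type}

/-! ### Simplified patterns -/

theorem length_add_le_getLast {h : Q → ℕ} {R : Q → Q → Prop} (hR : ∀ u v, R u v → h u < h v)
    (p : List Q) (hp : p.IsChain R) (hne : p ≠ []) :
    h (p.head hne) + p.length ≤ h (p.getLast hne) + 1 := by
  induction p with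
  | nil => exact absurd rfl hne
  | cons a p ih =>
    cases p with
    | nil => simp
    | cons b p =>
      rw [List.isChain_cons_cons] at hp
      have := ih hp.2 (by simp)
      have := hR _ _ hp.1
      simp only [List.head_cons, List.length_cons, ne_eq, reduceCtorEq, not_false_eq_true,
        List.getLast_cons] at *
      omega

theorem length_le_of_bounded {h : Q → ℕ} {R : Q → Q → Prop} (hR : ∀ u v, R u v → h u < h v)
    {m : ℕ} (p : List Q) (hp : p.IsChain R) (hm : ∀ v ∈ p, 0 < h v ∧ h v ≤ m) :
    p.length ≤ m := by
  by_cases hne : p = []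
  · simp [hne]
  · have h1 := length_add_le_getLast hR p hp hne
    have h2 := hm _ (List.head_mem hne)
    have h3 := hm _ (List.getLast_mem hne)
    omega

open Command in
theorem Pattern.arc_lt {h : Q → ℕ} {qs : Finset Q} {P : Pattern Q}
    (hP : ∀ c ∈ P.commands, Graded h qs c) (u v : Q) (huv : P.Arc u v) : h u < h v := by
  obtain ⟨α, s, t, hM, hu | hu⟩ | ⟨s, hX | hZ, hu⟩ := huv
  · exact (hP _ hM).1 u hu
  · exact (hP _ hM).2 u hu
  · exact (hP _ hX).2 u hu
  · exact (hP _ hZ).2 u hu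

open Command in
theorem exists_standard_split {l : List (Command Q)} (hl : l.Pairwise InOrder)
    (hs : ∀ c ∈ l, c.NotShift) :
    ∃ cs ms es : List (Command Q), l = cs ++ ms ++ es ∧
      (∀ c ∈ cs, c.isCorrection = true) ∧ (∀ c ∈ ms, c.isMeasurement = true) ∧
      (∀ c ∈ es, c.isEntanglement = true) := by
  induction l with
  | nil => exact ⟨[], [], [], by simp⟩
  | cons c l ih =>
    rw [List.pairwise_cons] at hl
    obtain ⟨cs, ms, es, rfl, h1, h2, h3⟩ := ih hl.2 fun d hd => hs d (by simp [hd])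
    have correction : c.isCorrection = true → _ := fun hc =>
      (⟨c :: cs, ms, es, rfl, by simpa [hc] using h1, h2, h3⟩ :
        ∃ cs' ms' es' : List (Command Q), c :: (cs ++ ms ++ es) = cs' ++ ms' ++ es' ∧
        (∀ c ∈ cs', c.isCorrection = true) ∧ (∀ c ∈ ms', c.isMeasurement = true) ∧
        (∀ c ∈ es', c.isEntanglement = true))
    cases c with
    | X => exact correction rfl
    | Z => exact correction rfl
    | S => exact absurd (hs _ List.mem_cons_self) id
    | M i α s t =>
      have : cs = [] := by
        refine List.eq_nil_iff_forall_not_mem.2 fun d hd => ?_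
        have h4 := hl.1 d (by simp [hd])
        have h5 := h1 d hd
        cases d <;> simp_all [InOrder, isCorrection]
      subst this
      exact ⟨[], .M i α s t :: ms, es, rfl, by simp, by simpa [isMeasurement] using h2, h3⟩
    | E i j =>
      refine ⟨[], [], .E i j :: (cs ++ ms ++ es), rfl, by simp, by simp, ?_⟩
      intro d hd
      rcases List.mem_cons.1 hd with rfl | hd
      · rfl
      · have h4 := hl.1 d hd
        cases d <;> simp_all [InOrder, isEntanglement]

variable [DecidableEq Q]

open Command in
/-- The properties of a simplified pattern that follow from the invariant of the original pattern.
If the commands of a pattern satisfy the invariant for a function `h` that takes its values on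
the qubits between `1` and `m + 1`, and on the measured qubits at most the value `m`, then along
every arc of the execution digraph of the simplified pattern `h` increases. -/
theorem Pattern.Simplifies.properties {R P : Pattern Q} (hRP : R.Simplifies P) {h : Q → ℕ}
    (hR : Invariant (Graded h R.qubits) (Compatible h) R.commands)
    (hs : ∀ c ∈ R.commands, c.NotShift)
    (hM : ∀ q ∈ R.qubits, q ∉ R.outputs → q ∈ R.commands.filterMap measured) {m : ℕ}
    (hm : ∀ q ∈ R.qubits, 0 < h q ∧ h q ≤ m + 1)
    (hm' : ∀ q ∈ R.qubits, q ∉ R.outputs → h q ≤ m) :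
    P.IsStandard ∧ P.Acyclic ∧
    P.numMeasurements = (R.commands.filterMap measured).length ∧
    (∀ c ∈ P.commands, c.isCorrection = true → ∃ q ∈ P.outputs, c.ActsOn q) ∧
    P.measurementDepth ≤ (m : ℕ∞) ∧ P.depth ≤ ((m + 1 : ℕ) : ℕ∞) := by
  obtain ⟨hq, -, ho, l, hl, hl'⟩ := hRP
  rw [← hq, ← ho] at hM hm'
  rw [← hq] at hR hm
  have inv := hl.preserves StdStep.invariant hR
  have shift := hl.preserves StdStep.notShift hs
  have inv' := hl'.preserves SigStep.invariant inv
  have order := (hl'.preserves SigStep.inOrder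
    ⟨fun _ _ => trivial, pairwise_inOrder_of_normal inv shift hl.2⟩).2
  have meas : P.commands.filterMap measured = R.commands.filterMap measured :=
    hl'.preserves (p := fun x => x.filterMap measured = R.commands.filterMap measured)
      (fun x y hxy hx => hxy.filterMap_measured.trans hx)
      (hl.preserves (p := fun x => x.filterMap measured = R.commands.filterMap measured)
        (fun x y hxy hx => hxy.filterMap_measured.trans hx) rfl)
  have std := exists_standard_split order (notShift_of_normal order hl'.2)
  have arc := P.arc_lt inv'.1
  refine ⟨std, ?_, ?_, ?_, ?_, ?_⟩
  · have : ∀ u v, Relation.TransGen P.Arc u v → h u < h v := fun u v huv => by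
      induction huv with
      | single h1 => exact arc _ _ h1
      | tail _ h1 ih => exact ih.trans (arc _ _ h1)
    exact fun v hv => lt_irrefl _ (this v v hv)
  · rw [← meas, Pattern.numMeasurements]
    generalize P.commands = x
    induction x with
    | nil => rfl
    | cons c x ih => cases c <;> simp [List.filterMap_cons, List.countP_cons, measured,
        isMeasurement, ih]
  · -- A correction on a measured qubit would be executed after the measurement.
    have key : ∀ c ∈ P.commands, c.isCorrection = true → ∀ q ∈ P.qubits,
        (∀ α s t, ¬ Compatible h c (.M q α s t)) → q ∈ P.outputs := by
      intro c hc hcc q hqq hcq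
      by_contra hqo
      have h1 := hM q hqq hqo
      rw [← meas, List.mem_filterMap] at h1
      obtain ⟨d, hd, hdq⟩ := h1
      obtain ⟨α, s, t, rfl⟩ : ∃ α s t, d = .M q α s t := by
        cases d <;> simp_all [measured]
      obtain ⟨cs, ms, es, heq, hcs, hms, hes⟩ := std
      have hpw := inv'.2
      rw [heq, List.append_assoc, List.pairwise_append] at hpw
      rw [heq, List.append_assoc, List.mem_append] at hc hd
      refine hcq α s t (hpw.2.2 c ?_ _ ?_)
      · refine hc.resolve_right fun hc => ?_
        rcases List.mem_append.1 hc with hc | hc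
        · have := hms c hc
          cases c <;> simp_all [isCorrection, isMeasurement]
        · have := hes c hc
          cases c <;> simp_all [isCorrection, isEntanglement]
      · exact hd.resolve_left fun hd => by simpa [isCorrection] using hcs _ hd
    intro c hc hcc
    have hg := inv'.1 c hc
    cases c with
    | X i s => exact ⟨i, key _ hc hcc i hg.1 fun _ _ _ hx => hx rfl, rfl⟩
    | Z i s => exact ⟨i, key _ hc hcc i hg.1 fun _ _ _ hx => hx rfl, rfl⟩
    | _ => simp [isCorrection] at hcc
  · refine iSup₂_le fun p hp => ?_
    exact_mod_cast length_le_of_bounded arc p hp.1.2 fun v hv =>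
      ⟨(hm v (hp.1.1 v hv)).1, hm' v (hp.1.1 v hv) (hp.2 v hv)⟩
  · refine iSup₂_le fun p hp => ?_
    exact_mod_cast length_le_of_bounded arc p hp.1.2 fun v hv => hm v (hp.1.1 v hv)

end

/-! ### The pattern of a sequence of elements -/

section

variable {n : ℕ}

/-- If `d w` bounds the number of elements on a path that ends on the wire `w`, then `e.level d`
gives such bounds after the element `e`. -/
def Element.level : Element n → (Fin n → ℕ) → (Fin n → ℕ)
  | .gate (.CZ a b _), d =>
      Function.update (Function.update d a (max (d a) (d b) + 1)) b (max (d a) (d b) + 1)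
  | .gate (.J w _), d => Function.update d w (d w + 1)
  | .teleport w, d => Function.update d w (d w + 1)

/-- The levels of the wires after a sequence of elements. -/
def levelFrom : List (Element n) → (Fin n → ℕ) → (Fin n → ℕ)
  | [], d => d
  | e :: l, d => levelFrom l (e.level d)

/-- The function `h` gives each measured qubit the level of the element that measures it, and each
output qubit one more than the final level of its wire. Here `k` gives the current last qubits and
`d` the current levels of the wires. -/
def IsHeight (h : Qubit n → ℕ) : List (Element n) → (Fin n → ℕ) → (Fin n → ℕ) → Prop
  | [], k, d => ∀ w, h (w, k w) = d w + 1
  | .gate (.CZ a b hab) :: l, k, d => IsHeight h l k (Element.level (.gate (.CZ a b hab)) d)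
  | .gate (.J w α) :: l, k, d => h (w, k w) = d w + 1 ∧
      IsHeight h l (Element.advance (.gate (.J w α)) k) (Element.level (.gate (.J w α)) d)
  | .teleport w :: l, k, d => h (w, k w) = d w + 1 ∧ h (w, k w + 1) = d w + 1 ∧
      IsHeight h l (Element.advance (.teleport w) k) (Element.level (.teleport w) d)

theorem Element.le_advance (e : Element n) (k : Fin n → ℕ) (w : Fin n) : k w ≤ e.advance k w := by
  rcases e with (⟨a, b, hab⟩ | ⟨v, α⟩) | v
  · exact le_rfl
  all_goals
    simp only [advance, Function.update_apply]
    split_ifs with h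
    · subst h; omega
    · exact le_rfl

theorem Element.le_level (e : Element n) (d : Fin n → ℕ) (w : Fin n) : d w ≤ e.level d w := by
  rcases e with (⟨a, b, hab⟩ | ⟨v, α⟩) | v
  all_goals
    simp only [level, Function.update_apply]
    split_ifs <;> subst_vars <;> omega

theorem le_lastFrom (l : List (Element n)) (k : Fin n → ℕ) (w : Fin n) : k w ≤ lastFrom l k w := by
  induction l generalizing k with
  | nil => exact le_rfl
  | cons e l ih => exact (e.le_advance k w).trans (ih _)

theorem le_levelFrom (l : List (Element n)) (d : Fin n → ℕ) (w : Fin n) :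
    d w ≤ levelFrom l d w := by
  induction l generalizing d with
  | nil => exact le_rfl
  | cons e l ih => exact (e.le_level d w).trans (ih _)

theorem IsHeight.congr {h h' : Qubit n → ℕ} {l : List (Element n)} {k d : Fin n → ℕ}
    (hh : IsHeight h l k d) (heq : ∀ w j, k w ≤ j → h (w, j) = h' (w, j)) :
    IsHeight h' l k d := by
  induction l generalizing k d with
  | nil => exact fun w => (heq w _ le_rfl) ▸ hh w
  | cons e l ih =>
    have key := fun w j hj => heq w j ((e.le_advance k w).trans hj)
    rcases e with (⟨a, b, hab⟩ | ⟨v, α⟩) | v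
    · exact ih hh key
    · exact ⟨heq v _ le_rfl ▸ hh.1, ih hh.2 key⟩
    · exact ⟨heq v _ le_rfl ▸ hh.1, heq v _ (Nat.le_succ _) ▸ hh.2.1, ih hh.2.2 key⟩

theorem exists_isHeight (l : List (Element n)) (k d : Fin n → ℕ) : ∃ h, IsHeight h l k d := by
  induction l generalizing k d with
  | nil => exact ⟨fun q => d q.1 + 1, fun w => rfl⟩
  | cons e l ih =>
    obtain ⟨h, hh⟩ := ih (e.advance k) (e.level d)
    rcases e with (⟨a, b, hab⟩ | ⟨v, α⟩) | v
    · exact ⟨h, hh⟩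
    · refine ⟨fun q => if q.1 = v ∧ q.2 ≤ k v then d v + 1 else h q, by simp, hh.congr ?_⟩
      intro w j hj
      rw [if_neg]
      rintro ⟨rfl, h2⟩
      simp [Element.advance] at hj h2
      omega
    · refine ⟨fun q => if q.1 = v ∧ q.2 ≤ k v + 1 then d v + 1 else h q, by simp, by simp,
        hh.congr ?_⟩
      intro w j hj
      rw [if_neg]
      rintro ⟨rfl, h2⟩
      simp [Element.advance] at hj h2
      omega

/-- The current last qubit of a wire is measured by a later element, or not at all. -/
theorem IsHeight.current_lt {h : Qubit n → ℕ} {l : List (Element n)} {k d : Fin n → ℕ}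
    (hh : IsHeight h l k d) (w : Fin n) : d w < h (w, k w) := by
  induction l generalizing k d with
  | nil => exact (hh w) ▸ Nat.lt_succ_self _
  | cons e l ih =>
    rcases e with (⟨a, b, hab⟩ | ⟨v, α⟩) | v
    · exact (Element.le_level _ d w).trans_lt (ih hh)
    · by_cases hw : w = v
      · subst hw; exact hh.1 ▸ Nat.lt_succ_self _
      · simpa [Element.advance, Element.level, hw] using ih hh.2
    · by_cases hw : w = v
      · subst hw; exact hh.1 ▸ Nat.lt_succ_self _
      · simpa [Element.advance, Element.level, hw] using ih hh.2.2

theorem IsHeight.bounds {h : Qubit n → ℕ} {l : List (Element n)} {k d : Fin n → ℕ}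
    (hh : IsHeight h l k d) (w : Fin n) (j : ℕ) (hj : k w ≤ j) (hj' : j ≤ lastFrom l k w) :
    d w < h (w, j) ∧ h (w, j) ≤ levelFrom l d w + 1 ∧
      (j < lastFrom l k w → h (w, j) ≤ levelFrom l d w) := by
  induction l generalizing k d with
  | nil =>
    obtain rfl : j = k w := le_antisymm hj' hj
    simp [lastFrom, levelFrom, hh w]
  | cons e l ih =>
    have h1 := e.le_level d w
    have h2 := le_levelFrom l (e.level d) w
    rcases e with (⟨a, b, hab⟩ | ⟨v, α⟩) | v
    · have := ih hh hj hj'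
      exact ⟨by omega, this.2⟩
    · by_cases hc : Element.advance (.gate (.J v α)) k w ≤ j
      · have := ih hh.2 hc hj'
        exact ⟨by omega, this.2⟩
      · obtain ⟨rfl, rfl⟩ : v = w ∧ j = k w := by
          simp only [Element.advance, Function.update_apply] at hc
          split_ifs at hc with hw
          · subst hw; exact ⟨rfl, by omega⟩
          · omega
        simp only [Element.level, Function.update_self] at h1 h2
        simp only [levelFrom, Element.level, hh.1]
        omega
    · by_cases hc : Element.advance (.teleport v) k w ≤ j
      · have := ih hh.2.2 hc hj'
        exact ⟨by omega, this.2⟩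
      · obtain ⟨rfl, hj⟩ : v = w ∧ (j = k w ∨ j = k w + 1) := by
          simp only [Element.advance, Function.update_apply] at hc
          split_ifs at hc with hw
          · subst hw; exact ⟨rfl, by omega⟩
          · omega
        have hv : h (v, j) = d v + 1 := by rcases hj with rfl | rfl; exacts [hh.1, hh.2.1]
        simp only [Element.level, Function.update_self] at h1 h2
        simp only [levelFrom, Element.level, hv]
        omega

theorem bounds_of_actsOn (l : List (Element n)) (k : Fin n → ℕ) :
    ∀ c ∈ commandsFrom l k, ∀ q, c.ActsOn q → k q.1 ≤ q.2 ∧ q.2 ≤ lastFrom l k q.1 := by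
  induction l generalizing k with
  | nil => simp [commandsFrom]
  | cons e l ih =>
    intro c hc q hq
    rw [commandsFrom, List.mem_append] at hc
    rcases hc with hc | hc
    · exact ⟨(e.le_advance k _).trans (ih _ c hc q hq).1, (ih _ c hc q hq).2⟩
    · have key := le_lastFrom l (e.advance k) q.1
      rcases e with (⟨a, b, hab⟩ | ⟨v, α⟩) | v <;>
        simp only [Element.commands, List.mem_cons, List.not_mem_nil, or_false] at hc <;>
        rcases hc with rfl | rfl | rfl | rfl | rfl | rfl <;>
        simp only [Command.ActsOn] at hq <;>
        rcases hq with rfl | rfl <;>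
        simp [lastFrom, Element.advance] at key ⊢ <;> omega

theorem mem_measured_commandsFrom (l : List (Element n)) (k : Fin n → ℕ) (w : Fin n) (j : ℕ)
    (hj : k w ≤ j) (hj' : j < lastFrom l k w) :
    (w, j) ∈ (commandsFrom l k).filterMap Command.measured := by
  induction l generalizing k with
  | nil => simp [lastFrom] at hj'; omega
  | cons e l ih =>
    rw [commandsFrom, List.filterMap_append, List.mem_append]
    by_cases hc : e.advance k w ≤ j
    · exact .inl (ih _ hc hj')
    · right
      rcases e with (⟨a, b, hab⟩ | ⟨v, α⟩) | v <;>
        simp only [Element.advance, Function.update_apply] at hc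
      · omega
      all_goals
        split_ifs at hc with hw
        · subst hw
          simp [Element.commands, List.filterMap_cons, Command.measured]
          omega
        · omega

open Command in
/-- An `X`-correction of a current last qubit is compatible with all commands that are executed
later, provided that its signal consists of qubits whose height is at most the level of the wire:
a controlled-Z that meets the correction raises the level of the other wire above these heights, so
that the `Z`-correction that arises there is graded. -/
theorem IsHeight.compatible_X {h : Qubit n → ℕ} {l : List (Element n)} {k d : Fin n → ℕ}
    (hh : IsHeight h l k d) (w : Fin n) (s : Finset (Qubit n)) (hs : ∀ e ∈ s, h e ≤ d w) :
    ∀ c ∈ commandsFrom l k, Compatible h c (.X (w, k w) s) := by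
  induction l generalizing k d with
  | nil => simp [commandsFrom]
  | cons e l ih =>
    have far : ∀ c ∈ commandsFrom l (e.advance k), k w < e.advance k w →
        Compatible h c (.X (w, k w) s) := by
      intro c hc hlt
      have := bounds_of_actsOn l _ c hc (w, k w)
      cases c <;> simp only [Compatible]
      simp only [ActsOn] at this
      constructor <;> intro hq <;> have := this (by simp [hq]) <;> omega
    intro c hc
    rw [commandsFrom, List.mem_append] at hc
    have le := e.le_level d w
    rcases e with (⟨a, b, hab⟩ | ⟨v, α⟩) | v
    · rcases hc with hc | hc
      · exact ih hh (fun e he => (hs e he).trans le) c hc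
      · simp only [Element.commands, List.mem_cons, List.not_mem_nil, or_false] at hc
        subst hc
        have ha := IsHeight.current_lt (l := l) (d := Element.level (.gate (.CZ a b hab)) d) hh a
        have hb := IsHeight.current_lt (l := l) (d := Element.level (.gate (.CZ a b hab)) d) hh b
        simp only [Element.level, Function.update_self, Function.update_of_ne hab] at ha hb
        simp only [Compatible, Prod.mk.injEq]
        refine ⟨fun hq e he => ?_, fun hq e he => ?_⟩ <;> have := hs e he <;>
          rw [hq.1] at this <;> omega
    · by_cases hw : w = v
      · subst hw
        rcases hc with hc | hc
        · exact far c hc (by simp [Element.advance])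
        · simp only [Element.commands, List.mem_cons, List.not_mem_nil, or_false] at hc
          have := IsHeight.current_lt hh.2 w
          simp only [Element.advance, Element.level, Function.update_self] at this
          rcases hc with rfl | rfl | rfl <;> simp only [Compatible]
          refine ⟨fun _ e he => ?_, fun hq => by simp at hq⟩
          have := hs e he
          omega
      · rcases hc with hc | hc
        · have := ih hh.2 (by simpa [Element.level, hw] using hs) c hc
          simpa [Element.advance, hw] using this
        · simp only [Element.commands, List.mem_cons, List.not_mem_nil, or_false] at hc
          rcases hc with rfl | rfl | rfl <;> simp [Compatible, hw]
    · by_cases hw : w = v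
      · subst hw
        rcases hc with hc | hc
        · exact far c hc (by simp [Element.advance])
        · simp only [Element.commands, List.mem_cons, List.not_mem_nil, or_false] at hc
          have := hh.2.1
          rcases hc with rfl | rfl | rfl | rfl | rfl | rfl <;> simp only [Compatible]
          · exact ⟨fun hq => by simp at hq, fun hq => by simp at hq⟩
          · refine ⟨fun _ e he => ?_, fun hq => by simp at hq⟩
            have := hs e he
            omega
      · rcases hc with hc | hc
        · have := ih hh.2.2 (by simpa [Element.level, hw] using hs) c hc
          simpa [Element.advance, hw] using this
        · simp only [Element.commands, List.mem_cons, List.not_mem_nil, or_false] at hc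
          rcases hc with rfl | rfl | rfl | rfl | rfl | rfl <;> simp [Compatible, hw]

end

section

variable {n : ℕ}

open Command in
/-- The commands of the wild pattern satisfy the invariant of the rewriting systems. -/
theorem IsHeight.invariant {h : Qubit n → ℕ} {l : List (Element n)} {k d : Fin n → ℕ}
    (hh : IsHeight h l k d) {qs : Finset (Qubit n)}
    (hqs : ∀ w j, k w ≤ j → j ≤ lastFrom l k w → (w, j) ∈ qs) :
    Invariant (Graded h qs) (Compatible h) (commandsFrom l k) := by
  induction l generalizing k d with
  | nil => simp [Invariant, commandsFrom]
  | cons e l ih =>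
    have hl := ih (k := e.advance k) (d := e.level d)
    have hqs' := fun w j hj => hqs w j ((e.le_advance k w).trans hj)
    have le : ∀ w, e.advance k w ≤ lastFrom (e :: l) k w := le_lastFrom l (e.advance k)
    -- Later commands act only on qubits from the new last qubits on, and not on those that `e`
    -- measures.
    have hM : ∀ c ∈ commandsFrom l (e.advance k), ∀ w j α s t, j < e.advance k w →
        Compatible h c (.M (w, j) α s t) := by
      intro c hc w j α s t hj
      have := bounds_of_actsOn l _ c hc (w, j)
      cases c <;> simp only [Compatible, ActsOn] at this ⊢
      · constructor <;> intro hq <;> have := this (by simp [hq]) <;> omega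
      all_goals
        intro hq
        have := this hq
        omega
    have hE : ∀ c ∈ commandsFrom l (e.advance k), ∀ i j, Compatible h c (.E i j) := by
      intro c _ i j; cases c <;> simp [Compatible]
    have hZ : ∀ c ∈ commandsFrom l (e.advance k), ∀ i s, Compatible h c (.Z i s) := by
      intro c _ i s; cases c <;> simp [Compatible]
    suffices H : (IsHeight h l (e.advance k) (e.level d)) ∧
        Invariant (Graded h qs) (Compatible h) (e.commands k) ∧
        ∀ c ∈ commandsFrom l (e.advance k), ∀ b ∈ e.commands k, Compatible h c b by
      obtain ⟨hh', he, hc⟩ := H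
      have hl := hl hh' hqs'
      refine ⟨?_, List.pairwise_append.2 ⟨hl.2, he.2, hc⟩⟩
      intro c hc
      rcases List.mem_append.1 hc with hc | hc
      exacts [hl.1 c hc, he.1 c hc]
    rcases e with (⟨a, b, hab⟩ | ⟨v, α⟩) | v
    · refine ⟨hh, ?_, ?_⟩
      · simpa [Element.commands, Invariant, Graded] using
          ⟨hqs a _ le_rfl (le a), hqs b _ le_rfl (le b)⟩
      · simpa [Element.commands] using fun c hc => hE c hc _ _
    · have hlt := IsHeight.current_lt hh.2 v
      have h1 := hh.1
      have hv : Element.advance (.gate (.J v α)) k v = k v + 1 := by simp [Element.advance]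
      have le1 := hqs v (k v) le_rfl (by have := le v; omega)
      have le2 := hqs v (k v + 1) (by omega) (hv ▸ le v)
      have hX := IsHeight.compatible_X hh.2 v {(v, k v)} (by simp [Element.level, h1])
      simp only [hv, Element.level, Function.update_self] at hlt hX
      refine ⟨hh.2, ?_, ?_⟩
      · simp [Element.commands, Invariant, Graded, Compatible, le1, le2]
        omega
      · simp only [Element.commands, List.mem_cons, List.not_mem_nil, or_false]
        rintro c hc b (rfl | rfl | rfl)
        exacts [hX c hc, hM c hc _ _ _ _ _ (by omega), hE c hc _ _]
    · have hlt := IsHeight.current_lt hh.2.2 v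
      have h1 := hh.1
      have h2 := hh.2.1
      have hv : Element.advance (.teleport v) k v = k v + 2 := by simp [Element.advance]
      have le1 := hqs v (k v) le_rfl (by have := le v; omega)
      have le2 := hqs v (k v + 1) (by omega) (by have := le v; omega)
      have le3 := hqs v (k v + 2) (by omega) (hv ▸ le v)
      have hX := IsHeight.compatible_X hh.2.2 v {(v, k v + 1)} (by simp [Element.level, h2])
      simp only [hv, Element.level, Function.update_self] at hlt hX
      refine ⟨hh.2.2, ?_, ?_⟩
      · simp [Element.commands, Invariant, Graded, Compatible, le1, le2, le3]
        omega
      · simp only [Element.commands, List.mem_cons, List.not_mem_nil, or_false]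
        rintro c hc b (rfl | rfl | rfl | rfl | rfl | rfl)
        exacts [hX c hc, hZ c hc _ _, hM c hc _ _ _ _ _ (by omega), hM c hc _ _ _ _ _ (by omega),
          hE c hc _ _, hE c hc _ _]

theorem notShift_commandsFrom (l : List (Element n)) (k : Fin n → ℕ) :
    ∀ c ∈ commandsFrom l k, c.NotShift := by
  induction l generalizing k with
  | nil => simp [commandsFrom]
  | cons e l ih =>
    intro c hc
    rcases List.mem_append.1 hc with hc | hc
    · exact ih _ c hc
    · rcases e with (⟨a, b, hab⟩ | ⟨v, α⟩) | v <;>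
        simp only [Element.commands, List.mem_cons, List.not_mem_nil, or_false] at hc <;>
        rcases hc with rfl | rfl | rfl | rfl | rfl | rfl <;> trivial

theorem mem_qubits_wildPattern {l : List (Element n)} {q : Qubit n} :
    q ∈ (wildPattern l).qubits ↔ q.2 ≤ lastFrom l (fun _ => 0) q.1 := by
  obtain ⟨w, j⟩ := q
  simp only [wildPattern, Finset.mem_biUnion, Finset.mem_univ, Finset.mem_image,
    Finset.mem_range, Prod.mk.injEq, true_and]
  constructor
  · rintro ⟨w', j', h, rfl, rfl⟩; omega
  · exact fun h => ⟨w, j, by omega, rfl, rfl⟩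

theorem card_qubits_wildPattern (l : List (Element n)) :
    (wildPattern l).qubits.card = n + ∑ w, lastFrom l (fun _ => 0) w := by
  rw [wildPattern, Finset.card_biUnion]
  · simp [Finset.card_image_of_injective _ (Prod.mk_right_injective _), Finset.sum_add_distrib,
      add_comm]
  · intro v _ w _ hvw
    rw [Function.onFun, Finset.disjoint_left]
    simp only [Finset.mem_image]
    rintro _ ⟨i, _, rfl⟩ ⟨j, _, hj⟩
    exact hvw (Prod.ext_iff.1 hj).1.symm

theorem card_outputs_wildPattern (l : List (Element n)) : (wildPattern l).outputs.card = n := by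
  rw [wildPattern, Finset.card_image_of_injective _ fun v w h => (Prod.ext_iff.1 h).1]
  simp

theorem card_corrections {Q : Type} [DecidableEq Q] (P : Pattern Q) :
    P.corrections.card = P.outputs.card :=
  Finset.card_image_of_injective _ fun _ _ h => (Prod.ext_iff.1 h).1

theorem Pattern.Simplifies.properties_wildPattern {l : List (Element n)} {P : Pattern (Qubit n)}
    (hP : (wildPattern l).Simplifies P) {m : ℕ} (hm : ∀ w, levelFrom l (fun _ => 0) w ≤ m) :
    P.IsStandard ∧ P.Acyclic ∧
    P.numMeasurements = ((commandsFrom l fun _ => 0).filterMap Command.measured).length ∧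
    (∀ c ∈ P.commands, c.isCorrection = true → ∃ q ∈ P.outputs, c.ActsOn q) ∧
    P.measurementDepth ≤ (m : ℕ∞) ∧ P.depth ≤ ((m + 1 : ℕ) : ℕ∞) := by
  obtain ⟨h, hh⟩ := exists_isHeight l (fun _ => 0) (fun _ => 0)
  have ne_last : ∀ q ∈ (wildPattern l).qubits, q ∉ (wildPattern l).outputs →
      q.2 < lastFrom l (fun _ => 0) q.1 := fun q hq hq' =>
    (mem_qubits_wildPattern.1 hq).lt_of_ne fun heq =>
      hq' (Finset.mem_image.2 ⟨q.1, Finset.mem_univ _, Prod.ext rfl heq.symm⟩)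
  refine hP.properties (h := h) (m := m) (hh.invariant ?_) (notShift_commandsFrom _ _) ?_ ?_ ?_
  · exact fun w j _ hj => mem_qubits_wildPattern.2 hj
  · exact fun q hq hq' => mem_measured_commandsFrom l _ q.1 q.2 (Nat.zero_le _) (ne_last q hq hq')
  · intro q hq
    have := hh.bounds q.1 q.2 (Nat.zero_le _) (mem_qubits_wildPattern.1 hq)
    have := hm q.1
    simp only [Prod.mk.eta] at *
    omega
  · intro q hq hq'
    have := hh.bounds q.1 q.2 (Nat.zero_le _) (mem_qubits_wildPattern.1 hq)
    exact (this.2.2 (ne_last q hq hq')).trans (hm q.1)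

/-! ### Counting gates and qubits -/

theorem touches_J (v w : Fin n) (α : Real.Angle) : (Gate.J v α).Touches w ↔ w = v := Iff.rfl

theorem touches_CZ (a b w : Fin n) (h : a ≠ b) :
    (Gate.CZ a b h).Touches w ↔ w = a ∨ w = b := Iff.rfl

/-- The gates of the circuit that act on the wire `w`. -/
def Circuit.onWire (C : Circuit n) (w : Fin n) : List (Gate n) :=
  List.filter (fun g => decide (g.Touches w)) C

theorem Circuit.onWire_cons (g : Gate n) (C : Circuit n) (w : Fin n) :
    Circuit.onWire (g :: C) w = if g.Touches w then g :: C.onWire w else C.onWire w := by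
  simp [onWire, List.filter_cons]

theorem Circuit.sum_countP_isJ (C : Circuit n) :
    ∑ w, (C.onWire w).countP Gate.isJ = C.numJ := by
  induction C with
  | nil => simp [onWire, numJ]
  | cons g C ih =>
    have : ∀ w, (Circuit.onWire (g :: C) w).countP Gate.isJ =
        (Circuit.onWire C w).countP Gate.isJ + if g.Touches w ∧ g.isJ then 1 else 0 := by
      intro w
      rw [onWire_cons]
      split_ifs <;> simp_all
    simp only [this, Finset.sum_add_distrib, ih, numJ, List.countP_cons]
    congr 1
    cases g <;> simp [Gate.isJ, touches_J]

theorem Circuit.sum_length_onWire_le (C : Circuit n) :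
    ∑ w, (C.onWire w).length ≤ 2 * C.size := by
  induction C with
  | nil => simp [onWire]
  | cons g C ih =>
    have : ∀ w, (Circuit.onWire (g :: C) w).length =
        (Circuit.onWire C w).length + if g.Touches w then 1 else 0 := by
      intro w
      rw [onWire_cons]
      split_ifs <;> simp_all
    have hg : ∑ w, (if g.Touches w then 1 else 0) ≤ 2 := by
      rw [← Finset.card_filter]
      cases g with
      | J v α => simp [touches_J, Finset.filter_eq']
      | CZ a b h =>
        refine (Finset.card_le_card (t := {a, b}) fun w => ?_).trans Finset.card_le_two
        simp [touches_CZ]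
    simp only [this, Finset.sum_add_distrib, size, List.length_cons] at ih ⊢
    omega

/-- The number of adjacent pairs of controlled-Z gates in a list of gates that is preceded by a
controlled-Z gate if `b` holds. -/
def czPairsAfter (b : Bool) : List (Gate n) → ℕ
  | [] => 0
  | g :: l => (if b && g.isCZ then 1 else 0) + czPairsAfter g.isCZ l

theorem czPairs_cons (g : Gate n) (l : List (Gate n)) :
    czPairs (g :: l) = czPairsAfter g.isCZ l := by
  induction l generalizing g with
  | nil => rfl
  | cons h l ih => rw [czPairs, czPairsAfter, ih]

theorem czPairsAfter_false (l : List (Gate n)) : czPairsAfter false l = czPairs l := by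
  cases l with
  | nil => rfl
  | cons g l => simp [czPairs_cons, czPairsAfter]

theorem czPairsAfter_le (b : Bool) (l : List (Gate n)) : czPairsAfter b l ≤ l.length := by
  induction l generalizing b with
  | nil => exact le_rfl
  | cons g l ih =>
    have := ih g.isCZ
    simp only [czPairsAfter, List.length_cons]
    split_ifs <;> omega

theorem Circuit.numConsecutiveCZ_eq (C : Circuit n) :
    C.numConsecutiveCZ = ∑ w, czPairsAfter false (C.onWire w) := by
  simp only [czPairsAfter_false]
  rfl

theorem Circuit.numConsecutiveCZ_le (C : Circuit n) : C.numConsecutiveCZ ≤ 2 * C.size := by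
  rw [numConsecutiveCZ_eq]
  exact (Finset.sum_le_sum fun w _ => czPairsAfter_le _ _).trans C.sum_length_onWire_le

theorem Circuit.numJ_le_size (C : Circuit n) : C.numJ ≤ C.size := List.countP_le_length

theorem lastFrom_map_gate (C : Circuit n) (k : Fin n → ℕ) (w : Fin n) :
    lastFrom (C.map Element.gate) k w = k w + (C.onWire w).countP Gate.isJ := by
  induction C generalizing k with
  | nil => simp [lastFrom, Circuit.onWire]
  | cons g C ih =>
    rw [List.map_cons, lastFrom, ih, Circuit.onWire_cons]
    cases g with
    | CZ a b h =>
      rw [Element.advance]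
      split_ifs <;> simp [Gate.isJ]
    | J v α =>
      simp only [touches_J, Element.advance, Function.update_apply]
      split_ifs with hw
      · subst hw; simp [List.countP_cons, Gate.isJ]; omega
      · rfl

theorem lastFrom_append (l l' : List (Element n)) (k : Fin n → ℕ) :
    lastFrom (l ++ l') k = lastFrom l' (lastFrom l k) := by
  induction l generalizing k with
  | nil => rfl
  | cons e l ih => exact ih _

theorem levelFrom_append (l l' : List (Element n)) (d : Fin n → ℕ) :
    levelFrom (l ++ l') d = levelFrom l' (levelFrom l d) := by
  induction l generalizing d with
  | nil => rfl
  | cons e l ih => exact ih _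

/-- A teleportation takes up two qubits, and there is one for each pair of consecutive controlled-Z
gates on the wire; `last w` counts as a controlled-Z gate in front of the circuit. -/
theorem lastFrom_insertTeleports (C : Circuit n) (last : Fin n → Bool) (k : Fin n → ℕ)
    (w : Fin n) :
    lastFrom (insertTeleports C last) k w =
      k w + (C.onWire w).countP Gate.isJ + 2 * czPairsAfter (last w) (C.onWire w) := by
  induction C generalizing last k with
  | nil => simp [insertTeleports, lastFrom, Circuit.onWire, czPairsAfter]
  | cons g C ih =>
    rw [Circuit.onWire_cons]
    cases g with
    | J v α =>
      rw [insertTeleports, lastFrom, ih]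
      simp only [touches_J, Element.advance, Function.update_apply]
      split_ifs with hw
      · subst hw; simp [List.countP_cons, Gate.isJ, Gate.isCZ, czPairsAfter]; omega
      · rfl
    | CZ a b h =>
      have teleport : ∀ v (k : Fin n → ℕ),
          lastFrom (if last v then [Element.teleport v] else []) k w =
            k w + if w = v ∧ last v then 2 else 0 := by
        intro v k
        by_cases hl : last v <;> by_cases hw : w = v <;>
          simp [hl, hw, lastFrom, Element.advance]
      rw [insertTeleports, lastFrom_append, lastFrom_append, lastFrom, ih, Element.advance,
        teleport, teleport]
      simp only [touches_CZ, Function.update_apply]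
      by_cases hb : w = b
      · subst hb
        simp [h.symm, Gate.isJ, Gate.isCZ, czPairsAfter]
        split_ifs <;> omega
      · by_cases ha : w = a
        · subst ha
          simp [hb, Gate.isJ, Gate.isCZ, czPairsAfter]
          split_ifs <;> omega
        · simp [ha, hb]

theorem length_measured_map_gate (C : Circuit n) (k : Fin n → ℕ) :
    ((commandsFrom (C.map Element.gate) k).filterMap Command.measured).length = C.numJ := by
  induction C generalizing k with
  | nil => rfl
  | cons g C ih =>
    rw [List.map_cons, commandsFrom, List.filterMap_append, List.length_append, ih]
    cases g <;>
      simp [Element.commands, List.filterMap_cons, Command.measured, Circuit.numJ, Gate.isJ,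
        List.countP_cons]

/-! ### Levels and the depth of the circuit -/

theorem Circuit.IsPath.length_le_depth {C : Circuit n} {p : List (Gate n)} (hp : C.IsPath p) :
    p.length ≤ C.depth := by
  refine le_csSup ⟨C.size, ?_⟩ ⟨p, hp, rfl⟩
  rintro _ ⟨q, hq, rfl⟩
  exact hq.1.length_le

/-- A path in `g :: C` is obtained from one in `C` by putting `g` in front of it if `g` acts on the
wire on which the path starts. -/
theorem exists_path_cons {g : Gate n} {C : Circuit n} {p : List (Gate n)} {v : Fin n}
    {d d' : Fin n → ℕ} {c m : ℕ} (hp : Circuit.IsPath C p) (hv : ∀ f ∈ p.head?, f.Touches v)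
    (hm : m ≤ c * p.length + d' v) (hd : ¬ g.Touches v → d' v = d v)
    (hd' : g.Touches v → ∃ v', g.Touches v' ∧ d' v ≤ d v' + c) :
    ∃ p v, Circuit.IsPath (g :: C) p ∧ (∀ f ∈ p.head?, f.Touches v) ∧
      m ≤ c * p.length + d v := by
  by_cases h : g.Touches v
  · obtain ⟨v', h1, h2⟩ := hd' h
    refine ⟨g :: p, v', ⟨hp.1.cons_cons g, ?_⟩, by simpa using h1, ?_⟩
    · exact List.isChain_cons.2 ⟨fun f hf => ⟨v, h, hv f hf⟩, hp.2⟩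
    · rw [List.length_cons, mul_add]; omega
  · exact ⟨p, v, ⟨hp.1.cons g, hp.2⟩, hv, hd h ▸ hm⟩

/-- If a controlled-Z meets levels that exceed the old ones by at most `c`, then the new levels
exceed the old level of one of its two wires by at most `c + 1`. -/
theorem Element.exists_level_CZ {a b : Fin n} (h : a ≠ b) (d d' : Fin n → ℕ) (c : ℕ)
    (ha : d' a ≤ d a + c) (hb : d' b ≤ d b + c) (v : Fin n) (hv : v = a ∨ v = b) :
    ∃ v', (Gate.CZ a b h).Touches v' ∧
      Element.level (.gate (.CZ a b h)) d' v ≤ d v' + (c + 1) := by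
  have : Element.level (.gate (.CZ a b h)) d' v = max (d' a) (d' b) + 1 := by
    rcases hv with rfl | rfl <;> simp [level, h]
  rw [this]
  rcases le_total (d' a) (d' b) with hab | hab
  · exact ⟨b, .inr rfl, by rw [max_eq_right hab]; omega⟩
  · exact ⟨a, .inl rfl, by rw [max_eq_left hab]; omega⟩

/-- The level of a wire is reached along a path, which starts from the initial level of a wire on
which its first gate acts. -/
theorem exists_path_levelFrom_map_gate (C : Circuit n) (d : Fin n → ℕ) (w : Fin n) :
    ∃ p v, C.IsPath p ∧ (∀ f ∈ p.head?, f.Touches v) ∧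
      levelFrom (C.map Element.gate) d w ≤ 1 * p.length + d v := by
  induction C generalizing d with
  | nil => exact ⟨[], w, ⟨.slnil, .nil⟩, by simp, by simp [levelFrom]⟩
  | cons g C ih =>
    obtain ⟨p, v, hp, hv, hm⟩ := ih (Element.level (.gate g) d)
    refine exists_path_cons hp hv hm ?_ ?_
    · cases g <;> simp +contextual [touches_CZ, touches_J, Element.level]
    · cases g with
      | J u α => exact fun hu => ⟨v, hu, by obtain rfl := hu; simp [Element.level]⟩
      | CZ a b h => exact Element.exists_level_CZ h d d 0 le_rfl le_rfl v

/-- Each gate of a path raises the level by at most two: one for the gate, and one for a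
teleportation inserted in front of it. -/
theorem exists_path_levelFrom_insertTeleports (C : Circuit n) (last : Fin n → Bool)
    (d : Fin n → ℕ) (w : Fin n) :
    ∃ p v, C.IsPath p ∧ (∀ f ∈ p.head?, f.Touches v) ∧
      levelFrom (insertTeleports C last) d w ≤ 2 * p.length + d v := by
  induction C generalizing d last with
  | nil => exact ⟨[], w, ⟨.slnil, .nil⟩, by simp, by simp [levelFrom, insertTeleports]⟩
  | cons g C ih =>
    cases g with
    | J u α =>
      rw [insertTeleports, levelFrom]
      obtain ⟨p, v, hp, hv, hm⟩ := ih (Function.update last u false)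
        (Element.level (.gate (.J u α)) d)
      refine exists_path_cons hp hv hm ?_ ?_
      · simp +contextual [touches_J, Element.level]
      · exact fun hu => ⟨v, hu, by obtain rfl := hu; simp [Element.level]⟩
    | CZ a b h =>
      rw [insertTeleports, levelFrom_append, levelFrom_append, levelFrom]
      have teleport : ∀ v (d : Fin n → ℕ) w,
          levelFrom (if last v then [Element.teleport v] else []) d w =
            d w + if w = v ∧ last v then 1 else 0 := by
        intro v d w
        by_cases hl : last v <;> by_cases hw : w = v <;>
          simp [hl, hw, levelFrom, Element.level]
      obtain ⟨d', hd'⟩ : ∃ d', d' = levelFrom (if last b then [Element.teleport b] else [])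
        (levelFrom (if last a then [Element.teleport a] else []) d) := ⟨_, rfl⟩
      rw [← hd']
      have hd : ∀ w, d' w = d w + (if w = a ∧ last a then 1 else 0) +
          if w = b ∧ last b then 1 else 0 := fun w => by rw [hd', teleport, teleport]
      obtain ⟨p, v, hp, hv, hm⟩ := ih
        (Function.update (Function.update last a true) b true)
        (Element.level (.gate (.CZ a b h)) d')
      refine exists_path_cons hp hv hm ?_ ?_
      · intro hv
        rw [touches_CZ, not_or] at hv
        simp [Element.level, hv.1, hv.2, hd]
      · refine Element.exists_level_CZ h d d' 1 ?_ ?_ v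
        · rw [hd]; simp [h]; split_ifs <;> omega
        · rw [hd]; simp [h.symm]; split_ifs <;> omega

theorem levelFrom_map_gate_le (C : Circuit n) (w : Fin n) :
    levelFrom (C.map Element.gate) (fun _ => 0) w ≤ C.depth := by
  obtain ⟨p, v, hp, -, h⟩ := exists_path_levelFrom_map_gate C (fun _ => 0) w
  have := hp.length_le_depth
  omega

theorem levelFrom_insertTeleports_le (C : Circuit n) (w : Fin n) :
    levelFrom (insertTeleports C fun _ => false) (fun _ => 0) w ≤ 2 * C.depth := by
  obtain ⟨p, v, hp, -, h⟩ := exists_path_levelFrom_insertTeleports C (fun _ => false) (fun _ => 0) w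
  have := hp.length_le_depth
  omega

theorem Circuit.depth_pos {C : Circuit n} (hC : C ≠ []) : 0 < C.depth := by
  cases C with
  | nil => exact absurd rfl hC
  | cons g C => exact IsPath.length_le_depth (p := [g]) ⟨by simp, .singleton g⟩

end

end MBQC

theorem mainTheorem12 :
    (∀ (n : ℕ) (C : MBQC.Circuit n),
      (∃ P, MBQC.Corresponds C P) ∧
      ∀ P, MBQC.Corresponds C P →
        P.IsStandard ∧ P.Acyclic ∧
        P.qubits.card = n + C.numJ ∧
        P.numMeasurements = C.numJ ∧
        (P.corrections.card = n ∧
          ∀ c ∈ P.commands, c.isCorrection = true → ∃ q ∈ P.outputs, c.ActsOn q) ∧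
        P.measurementDepth ≤ (C.depth : ℕ∞) ∧
        P.depth ≤ ((C.depth + 1 : ℕ) : ℕ∞)) ∧
    (∀ (n : ℕ) (C : MBQC.Circuit n),
      (∃ P, MBQC.ClusterCorresponds C P) ∧
      ∀ P, MBQC.ClusterCorresponds C P →
        P.IsStandard ∧ P.Acyclic ∧
        P.qubits.card = n + C.numJ + 2 * C.numConsecutiveCZ) ∧
    (∃ c : ℕ, ∀ (n : ℕ) (C : MBQC.Circuit n),
      n + C.numJ + 2 * C.numConsecutiveCZ ≤ c * (n + C.size) ∧
      (C ≠ [] → ∀ P, MBQC.ClusterCorresponds C P → P.depth ≤ ((c * C.depth : ℕ) : ℕ∞))) := by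
  open MBQC in
  refine ⟨fun n C => ⟨Pattern.exists_simplifies _, fun P hP => ?_⟩,
    fun n C => ⟨Pattern.exists_simplifies _, fun P hP => ?_⟩, 5, fun n C => ⟨?_, fun hC P hP => ?_⟩⟩
  · obtain ⟨h1, h2, h3, h4, h5, h6⟩ := hP.properties_wildPattern (levelFrom_map_gate_le C)
    refine ⟨h1, h2, ?_, h3.trans (length_measured_map_gate C _), ⟨?_, h4⟩, h5, h6⟩
    · rw [hP.1, card_qubits_wildPattern]
      simp [lastFrom_map_gate, Circuit.sum_countP_isJ]
    · rw [card_corrections, hP.2.2.1, card_outputs_wildPattern]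
  · obtain ⟨h1, h2, -⟩ := hP.properties_wildPattern (levelFrom_insertTeleports_le C)
    refine ⟨h1, h2, ?_⟩
    rw [hP.1, card_qubits_wildPattern]
    simp [lastFrom_insertTeleports, Finset.sum_add_distrib, Circuit.sum_countP_isJ,
      ← Finset.mul_sum, Circuit.numConsecutiveCZ_eq, add_assoc]
  · have := C.numJ_le_size
    have := C.numConsecutiveCZ_le
    omega
  · obtain ⟨-, -, -, -, -, h⟩ := hP.properties_wildPattern (levelFrom_insertTeleports_le C)
    refine h.trans ?_
    -- The depth of a nonempty circuit is positive, which absorbs the additional layer.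
    have := Circuit.depth_pos hC
    exact_mod_cast (by omega : 2 * C.depth + 1 ≤ 5 * C.depth)
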